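/- **Setup.** Let $X$ be a (Hausdorff, finite-dimensional) complex manifold and let $Y\subseteq X$ be a (locally closed) reduced complex subspace with inclusion $f:Y\to X$. Let $\mathcal F\subseteq T_X$ be a subsheaf of $\mathbb C_X$-modules of the sheaf of holomorphic vector fields, closed under Lie bracket (here $\mathbb C_X$ is the sheaf of locally constant functions). Put $\mathcal F_Y:=\operatorname{Image}(f^{-1}\mathcal F\to f^*T_X)\subseteq f^*T_X$. Let $\mathcal G\subseteq\mathcal F_Y$ be an *obstruction sheaf* for $\mathcal F$: a subsheaf of abelian groups such that for every open $U\subseteq X$ and all $A_1,A_2\in\mathcal F(U)$ with $f^*A_1=f^*A_2$ one has $f^*[A_1,A_2]\in\mathcal G(f^{-1}(U))$. A time-dependent vector field $A\in H^0(X\times\mathbb C,\,p_X^*T_X)$, where $p_X:X\times\mathbb C\to X$ is the projection, is said to be *in* $\mathcal F$ if it is a finite sum $A=\sum_{i\ge 0}t^iA_i$ with $A_i\in H^0(X,\mathcal F)$. Write $D(A):=\frac{\partial}{\partial t}+A$, a vector field on $X\times\mathbb C$, let $\mathcal L_{D(A)}=[D(A),\,\cdot\,]$ denote the Lie derivative,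 and let a subscript $0$ denote restriction to $t=0$. For $n\ge1$, a field $A$ in $\mathcal F$ is *$n$-admissible for $\mathcal G$* if $$\bigl(\mathcal L_{D(A)}^m A\bigr)_0\big|_Y\in H^0(Y,\mathcal G)\qquad\text{for all }1\le m\le n .$$ For $x\in X$ let $\tau^n_A(x)$ be the $n$-th order jet at $x$ (class of holomorphic curve germs up to agreement to order $n$) of the integral curve $\gamma$ of $A$ given by $\gamma(0)=x$, $\gamma'(t)=A_t(\gamma(t))$. If two $(n+1)$-st order jets $\sigma,\tau$ at $x$ have the same $n$-th order part, their difference $\sigma-\tau\in T_X|_x$ is the tangent vector given in any chart by the difference of the $(n+1)$-st derivatives at $0$ of representing curves. **Proposition.** Let $n\ge 1$ and let $A,B$ be time-dependent vector fields in $\mathcal F$, both $n$-admissible for $\mathcal G$. If $\tau^n_A|_Y=\tau^n_B|_Y$, then $$\tau^{n+1}_B\big|_Y-\tau^{n+1}_A\big|_Y\in H^0(Y,\mathcal G).$$ -/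

import Mathlib

open scoped Manifold ContDiff Topology

namespace JetDeformation

open Set Filter TopologicalSpace VectorField

/-! ### Sheaves of sections

A subsheaf of abelian groups of the sheaf of all (set-theoretic) sections of a family `T z`, `z ∈ Z`,
of abelian groups. Sections over `U` are represented by functions on all of `Z`, of which only the
values at points of `U` matter (`congr`). -/

structure AbelianSubsheaf {Z : Type*} [TopologicalSpace Z] (T : Z → Type*)
    [∀ z, AddCommGroup (T z)] where
  /-- `IsSection U s` says that the restriction of `s` to `U` is a section over `U`. -/
  IsSection : Opens Z → (∀ z, T z) → Prop
  congr : ∀ {U : Opens Z} {s s' : ∀ z, T z}, (∀ z ∈ U, s z = s' z) →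
    IsSection U s → IsSection U s'
  mono : ∀ {U V : Opens Z} {s : ∀ z, T z}, V ≤ U → IsSection U s → IsSection V s
  glue : ∀ {U : Opens Z} {s : ∀ z, T z},
    (∀ z ∈ U, ∃ V : Opens Z, z ∈ V ∧ V ≤ U ∧ IsSection V s) → IsSection U s
  zero_mem : ∀ U : Opens Z, IsSection U 0
  add_mem : ∀ {U : Opens Z} {s s' : ∀ z, T z},
    IsSection U s → IsSection U s' → IsSection U (s + s')
  neg_mem : ∀ {U : Opens Z} {s : ∀ z, T z}, IsSection U s → IsSection U (-s)

section

variable (E : Type*) [NormedAddCommGroup E] [NormedSpace ℂ E]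
  (X : Type*) [TopologicalSpace X] [ChartedSpace E X]

/-- A subsheaf of `ℂ_X`-modules of the sheaf of holomorphic vector fields on the complex manifold
`X`, closed under Lie bracket. (Stability under multiplication by locally constant functions
follows from stability under multiplication by constants and the sheaf property.) -/
structure LieSubsheaf [IsManifold 𝓘(ℂ, E) ω X] extends
    AbelianSubsheaf (fun x : X => TangentSpace 𝓘(ℂ, E) x) where
  holomorphic : ∀ {U : Opens X} {A : ∀ x : X, TangentSpace 𝓘(ℂ, E) x}, IsSection U A →
    ContMDiffOn 𝓘(ℂ, E) 𝓘(ℂ, E).tangent ω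
      (fun x => (⟨x, A x⟩ : TangentBundle 𝓘(ℂ, E) X)) U
  smul_mem : ∀ {U : Opens X} {A : ∀ x : X, TangentSpace 𝓘(ℂ, E) x} (c : ℂ),
    IsSection U A → IsSection U (c • A)
  lie_mem : ∀ {U : Opens X} {A B : ∀ x : X, TangentSpace 𝓘(ℂ, E) x},
    IsSection U A → IsSection U B → IsSection U (mlieBracket 𝓘(ℂ, E) A B)

variable {X}

/-- `Y` is (the underlying set of) a reduced complex subspace of the complex manifold `X`: near each
of its points it is the common zero set of finitely many holomorphic functions. -/
def IsAnalyticSubset (Y : Set X) : Prop :=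
  ∀ y ∈ Y, ∃ U : Opens X, y ∈ U ∧ ∃ (k : ℕ) (h : Fin k → X → ℂ),
    (∀ i, ContMDiffOn 𝓘(ℂ, E) 𝓘(ℂ, ℂ) ω (h i) U) ∧ ∀ x ∈ U, (x ∈ Y ↔ ∀ i, h i x = 0)

end

section

variable {E : Type*} [NormedAddCommGroup E] [NormedSpace ℂ E]
  {X : Type*} [TopologicalSpace X] [ChartedSpace E X]

/-- The open subset `f⁻¹(U) = Y ∩ U` of `Y`, for `f : Y → X` the inclusion. -/
def openInter (Y : Set X) (U : Opens X) : Opens Y :=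
  U.comap ⟨Subtype.val, continuous_subtype_val⟩

/-- The sheaf `F_Y = Image (f⁻¹ F → f^* T_X)` on `Y`: its sections are locally restrictions to `Y`
of vector fields in `F`. As `Y` is reduced, a section of `f^* T_X` is given by its values, the
tangent vectors `s y ∈ T_X|_y`, `y ∈ Y`. -/
def inducedSheaf [IsManifold 𝓘(ℂ, E) ω X] (F : LieSubsheaf E X) (Y : Set X) :
    AbelianSubsheaf (fun y : Y => TangentSpace 𝓘(ℂ, E) (y : X)) where
  IsSection V s := ∀ y ∈ V, ∃ (U : Opens X) (A : ∀ x : X, TangentSpace 𝓘(ℂ, E) x),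
    (y : X) ∈ U ∧ F.IsSection U A ∧ ∀ z ∈ V, (z : X) ∈ U → s z = A z
  congr := by
    intro V s s' h hs y hy
    obtain ⟨U, A, hyU, hA, hsA⟩ := hs y hy
    exact ⟨U, A, hyU, hA, fun z hz hzU => (h z hz).symm.trans (hsA z hz hzU)⟩
  mono := by
    intro V W s hWV hs y hy
    obtain ⟨U, A, hyU, hA, hsA⟩ := hs y (hWV hy)
    exact ⟨U, A, hyU, hA, fun z hz hzU => hsA z (hWV hz) hzU⟩
  glue := by
    intro V s h y hy
    obtain ⟨W, hyW, hWV, hs⟩ := h y hy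
    obtain ⟨U, A, hyU, hA, hsA⟩ := hs y hyW
    obtain ⟨O, hO, hOW⟩ := isOpen_induced_iff.1 W.isOpen
    refine ⟨U ⊓ ⟨O, hO⟩, A, ⟨hyU, ?_⟩, F.mono inf_le_left hA, ?_⟩
    · change y ∈ Subtype.val ⁻¹' O
      rw [hOW]; exact hyW
    · rintro z - ⟨hzU, hzO⟩
      refine hsA z ?_ hzU
      change z ∈ (W : Set Y)
      rw [← hOW]; exact hzO
  zero_mem := fun V y _ => ⟨⊤, 0, trivial, F.zero_mem ⊤, fun _ _ _ => rfl⟩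
  add_mem := by
    intro V s s' hs hs' y hy
    obtain ⟨U, A, hyU, hA, hsA⟩ := hs y hy
    obtain ⟨U', A', hyU', hA', hsA'⟩ := hs' y hy
    refine ⟨U ⊓ U', A + A', ⟨hyU, hyU'⟩,
      F.add_mem (F.mono inf_le_left hA) (F.mono inf_le_right hA'), ?_⟩
    rintro z hz ⟨h, h'⟩
    simp only [Pi.add_apply, hsA z hz h, hsA' z hz h']
  neg_mem := by
    intro V s hs y hy
    obtain ⟨U, A, hyU, hA, hsA⟩ := hs y hy
    exact ⟨U, -A, hyU, F.neg_mem hA, fun z hz h => by simp only [Pi.neg_apply, hsA z hz h]⟩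

/-- `G ⊆ F_Y` is an obstruction sheaf for `F`: the Lie bracket of any two vector fields in `F` (over
any open set `U`) which agree along `Y` restricts to a section of `G`. -/
structure IsObstructionSheaf [IsManifold 𝓘(ℂ, E) ω X] (F : LieSubsheaf E X) (Y : Set X)
    (G : AbelianSubsheaf (fun y : Y => TangentSpace 𝓘(ℂ, E) (y : X))) : Prop where
  le_induced : ∀ (V : Opens Y) (s : ∀ y : Y, TangentSpace 𝓘(ℂ, E) (y : X)),
    G.IsSection V s → (inducedSheaf F Y).IsSection V s
  bracket_mem : ∀ (U : Opens X) (A₁ A₂ : ∀ x : X, TangentSpace 𝓘(ℂ, E) x),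
    F.IsSection U A₁ → F.IsSection U A₂ → (∀ y ∈ Y, y ∈ U → A₁ y = A₂ y) →
    G.IsSection (openInter Y U) (fun y => mlieBracket 𝓘(ℂ, E) A₁ A₂ (y : X))

/-! ### Jets -/

/-- Representatives of germs of holomorphic curves `γ : (ℂ, 0) → (X, x)`. -/
structure HolCurve (E : Type*) [NormedAddCommGroup E] [NormedSpace ℂ E]
    {X : Type*} [TopologicalSpace X] [ChartedSpace E X] (x : X) where
  toFun : ℂ → X
  map_zero : toFun 0 = x
  holomorphic : ContMDiffAt 𝓘(ℂ, ℂ) 𝓘(ℂ, E) ω toFun 0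

/-- The curve `γ`, read in the preferred chart at `x`. -/
noncomputable def HolCurve.inChart {x : X} (γ : HolCurve E x) : ℂ → E :=
  fun t => extChartAt 𝓘(ℂ, E) x (γ.toFun t)

/-- Agreement of curve germs to `n`-th order. -/
def jetSetoid (E : Type*) [NormedAddCommGroup E] [NormedSpace ℂ E]
    {X : Type*} [TopologicalSpace X] [ChartedSpace E X] (n : ℕ) (x : X) :
    Setoid (HolCurve E x) where
  r γ δ := ∀ k ≤ n, iteratedDeriv k γ.inChart 0 = iteratedDeriv k δ.inChart 0
  iseqv := ⟨fun _ _ _ => rfl, fun h k hk => (h k hk).symm,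
    fun h h' k hk => (h k hk).trans (h' k hk)⟩

/-- The fibre over `x` of the jet bundle `Jet^n(X)`: classes of germs of holomorphic curves at `x`,
where two germs are identified if they agree to `n`-th order. -/
def Jet (E : Type*) [NormedAddCommGroup E] [NormedSpace ℂ E]
    {X : Type*} [TopologicalSpace X] [ChartedSpace E X] (n : ℕ) (x : X) :=
  Quotient (jetSetoid E n x)

/-- The `n`-th derivative at `0` of a jet of order `n`, read in the preferred chart at `x`. -/
noncomputable def Jet.topDeriv {n : ℕ} {x : X} (σ : Jet E n x) : E :=
  Quotient.lift (fun γ : HolCurve E x => iteratedDeriv n γ.inChart 0)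
    (fun γ δ (h : (jetSetoid E n x).r γ δ) => h n le_rfl) σ

/-- The difference `σ - τ ∈ T_X|_x` of two jets at `x` of order `n + 1` whose `n`-th order parts
agree. It is the difference of the `(n + 1)`-st derivatives at `0`, computed in the preferred chart
at `x`, which is the chart through which `T_X|_x` is identified with the model space `E`. (If the
`n`-th order parts agree, then any other chart gives the same tangent vector.) -/
noncomputable def Jet.diff {n : ℕ} {x : X} (σ τ : Jet E (n + 1) x) : TangentSpace 𝓘(ℂ, E) x :=
  (σ.topDeriv - τ.topDeriv : E)

end

/-! ### Time-dependent vector fields -/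

/-- A time-dependent vector field on `X`: a holomorphic section over `X × ℂ` of `p_X^* T_X`. The
value `A t x` is the tangent vector at `x` at time `t`. -/
structure TimeDependentVectorField (E : Type*) [NormedAddCommGroup E] [NormedSpace ℂ E]
    (X : Type*) [TopologicalSpace X] [ChartedSpace E X] [IsManifold 𝓘(ℂ, E) ω X] where
  toFun : ℂ → ∀ x : X, TangentSpace 𝓘(ℂ, E) x
  holomorphic : ContMDiff (𝓘(ℂ, E).prod 𝓘(ℂ, ℂ)) 𝓘(ℂ, E).tangent ω
    (fun p : X × ℂ => (⟨p.1, toFun p.2 p.1⟩ : TangentBundle 𝓘(ℂ, E) X))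

section

open Metric

/-- Local existence of solutions of holomorphic ordinary differential equations. -/
theorem exists_holomorphic_solution {E : Type*} [NormedAddCommGroup E] [NormedSpace ℂ E]
    [CompleteSpace E] (f : ℂ × E → E) (x₀ : E) (hf : ContDiffAt ℂ 1 f (0, x₀)) :
    ∃ u : ℂ → E, u 0 = x₀ ∧ ∀ᶠ t in 𝓝 (0 : ℂ), HasDerivAt u (f (t, u t)) t := by
  obtain ⟨K, s, hs, hK⟩ := hf.exists_lipschitzOnWith
  have hd : ∀ᶠ p in 𝓝 ((0 : ℂ), x₀), DifferentiableAt ℂ f p :=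
    (hf.eventually (by simp)).mono fun p hp => hp.differentiableAt one_ne_zero
  have hM : ∀ᶠ p in 𝓝 ((0 : ℂ), x₀), ‖f p‖ < ‖f (0, x₀)‖ + 1 :=
    hf.continuousAt.norm.eventually_lt_const (lt_add_one _)
  obtain ⟨R, hR, hRs⟩ := Metric.eventually_nhds_iff_ball.1 (hd.and (hM.and hs))
  set M := ‖f (0, x₀)‖ + 1 with hMdef
  have hM0 : 0 < M := by positivity
  obtain ⟨r, hr0, hrR, hrM, hrK⟩ : ∃ r : ℝ, 0 < r ∧ r < R ∧ M * r < R ∧ K * r ≤ 1 / 2 := by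
    have e1 : ∀ᶠ r in 𝓝 (0 : ℝ), r < R := eventually_lt_nhds hR
    have e2 : ∀ᶠ r in 𝓝 (0 : ℝ), M * r < R :=
      (continuous_const.mul continuous_id).continuousAt.eventually_lt_const (by simpa using hR)
    have e3 : ∀ᶠ r in 𝓝 (0 : ℝ), (K : ℝ) * r < 1 / 2 :=
      (continuous_const.mul continuous_id).continuousAt.eventually_lt_const (by simp)
    obtain ⟨r, hr, h⟩ := (((e1.and (e2.and e3)).filter_mono
      (nhdsWithin_le_nhds (s := Ioi 0))).and self_mem_nhdsWithin).exists
    exact ⟨r, h, hr.1, hr.2.1, hr.2.2.le⟩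
  let S : Set (ℂ → E) := {u | DifferentiableOn ℂ u (ball 0 r) ∧ ∀ z ∈ ball (0 : ℂ) r, ‖u z - x₀‖ ≤ M * r}
  have hmem : ∀ u ∈ S, ∀ z ∈ ball (0 : ℂ) r, (z, u z) ∈ ball ((0 : ℂ), x₀) R := by
    intro u hu z hz
    rw [← ball_prod_same]
    refine ⟨ball_subset_ball hrR.le hz, ?_⟩
    rw [mem_ball_iff_norm]
    exact (hu.2 z hz).trans_lt hrM
  have h0 : (0 : ℂ) ∈ ball (0 : ℂ) r := mem_ball_self hr0
  have hbd : ∀ (w w' : ℂ → E) (C : ℝ), 0 ≤ C → w 0 = 0 →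
      (∀ z ∈ ball (0 : ℂ) r, HasDerivAt w (w' z) z) → (∀ z ∈ ball (0 : ℂ) r, ‖w' z‖ ≤ C) →
      ∀ z ∈ ball (0 : ℂ) r, ‖w z‖ ≤ C * r := by
    intro w w' C hC hw0 hw hw' z hz
    have := (convex_ball (0 : ℂ) r).norm_image_sub_le_of_norm_hasDerivWithin_le
      (fun z hz => (hw z hz).hasDerivWithinAt) hw' h0 hz
    rw [hw0, sub_zero, sub_zero] at this
    exact this.trans (mul_le_mul_of_nonneg_left (mem_ball_zero_iff.1 hz).le hC)
  have step : ∀ u : S, ∃ v : S, v.1 0 = x₀ ∧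
      ∀ z ∈ ball (0 : ℂ) r, HasDerivAt v.1 (f (z, u.1 z)) z := by
    rintro ⟨u, hu⟩
    have hdiff : DifferentiableOn ℂ (fun z => f (z, u z)) (ball 0 r) := by
      intro z hz
      exact ((hRs _ (hmem u hu z hz)).1.comp_differentiableWithinAt (x := z) (s := ball 0 r)
        (f := fun z => (z, u z)) (differentiableWithinAt_id.prodMk (hu.1 z hz)))
    obtain ⟨v, hv0, hv⟩ := hdiff.isExactOn_ball.with_val_at 0 x₀
    refine ⟨⟨v, fun z hz => (hv z hz).differentiableAt.differentiableWithinAt, ?_⟩, hv0, hv⟩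
    exact hbd (fun z => v z - x₀) _ M hM0.le (by simp [hv0]) (fun z hz => (hv z hz).sub_const x₀)
      (fun z hz => (hRs _ (hmem u hu z hz)).2.1.le)
  choose T hT0 hT using step
  let u₀ : S := ⟨fun _ => x₀, differentiableOn_const _, fun z _ => by simp; positivity⟩
  let U : ℕ → S := fun n => T^[n] u₀
  have hU : ∀ n, U (n + 1) = T (U n) := fun n => Function.iterate_succ_apply' T n u₀
  have hcontr : ∀ (u v : S) (c : ℝ), 0 ≤ c → (∀ z ∈ ball (0 : ℂ) r, ‖u.1 z - v.1 z‖ ≤ c) →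
      ∀ z ∈ ball (0 : ℂ) r, ‖(T u).1 z - (T v).1 z‖ ≤ c / 2 := by
    intro u v c hc huv z hz
    have := hbd (fun z => (T u).1 z - (T v).1 z) _ (K * c) (by positivity) (by simp [hT0])
      (fun z hz => (hT u z hz).sub (hT v z hz)) (fun z hz => ?_) z hz
    · refine this.trans ?_
      nlinarith
    · have := hK.norm_sub_le (hRs _ (hmem u u.2 z hz)).2.2 (hRs _ (hmem v v.2 z hz)).2.2
      refine this.trans (mul_le_mul_of_nonneg_left ?_ K.2)
      simpa [Prod.norm_def] using huv z hz
  have hgeo : ∀ n, ∀ z ∈ ball (0 : ℂ) r,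
      ‖(U n).1 z - (U (n + 1)).1 z‖ ≤ (M * r) / 2 ^ n := by
    intro n
    induction n with
    | zero =>
      intro z hz
      rw [norm_sub_rev]
      simpa [U, u₀] using (U 1).2.2 z hz
    | succ n ih =>
      intro z hz
      rw [hU (n + 1), hU n]
      rw [hU n] at ih
      have := hcontr _ _ _ (by positivity) ih z hz
      rwa [div_div, ← pow_succ] at this
  have hdist : ∀ z ∈ ball (0 : ℂ) r, ∀ n,
      dist ((U n).1 z) ((U (n + 1)).1 z) ≤ (2 * (M * r)) / 2 / 2 ^ n := by
    intro z hz n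
    rw [dist_eq_norm, mul_div_cancel_left₀ _ two_ne_zero]
    exact hgeo n z hz
  have hlim : ∀ z, ∃ y, z ∈ ball (0 : ℂ) r → Tendsto (fun n => (U n).1 z) atTop (𝓝 y) := by
    intro z
    by_cases hz : z ∈ ball (0 : ℂ) r
    · obtain ⟨y, hy⟩ := cauchySeq_tendsto_of_complete (cauchySeq_of_le_geometric_two (hdist z hz))
      exact ⟨y, fun _ => hy⟩
    · exact ⟨0, fun h => absurd h hz⟩
  choose u hu using hlim
  have hunif : TendstoUniformlyOn (fun n => (U n).1) u atTop (ball 0 r) := by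
    rw [Metric.tendstoUniformlyOn_iff]
    intro ε hε
    have : Tendsto (fun n : ℕ => (2 * (M * r)) / 2 ^ n) atTop (𝓝 0) := by
      have := (tendsto_pow_atTop_nhds_zero_of_lt_one (r := (1 / 2 : ℝ)) (by norm_num)
        (by norm_num)).const_mul (2 * (M * r))
      simpa [div_eq_mul_inv] using this
    filter_upwards [this.eventually_lt_const hε] with n hn z hz
    rw [dist_comm]
    exact (dist_le_of_le_geometric_two_of_tendsto (hdist z hz) (hu z hz) n).trans_lt hn
  have hloc := hunif.tendstoLocallyUniformlyOn
  have hUd : ∀ᶠ n in atTop, DifferentiableOn ℂ (U n).1 (ball 0 r) :=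
    Eventually.of_forall fun n => (U n).2.1
  have hud : DifferentiableOn ℂ u (ball 0 r) := hloc.differentiableOn hUd isOpen_ball
  have huS : u ∈ S := ⟨hud, fun z hz => le_of_tendsto ((hu z hz).sub_const x₀).norm
    (Eventually.of_forall fun n => (U n).2.2 z hz)⟩
  refine ⟨u, ?_, ?_⟩
  · refine tendsto_nhds_unique ((tendsto_add_atTop_iff_nat 1).2 (hu 0 h0)) ?_
    simp [hU, hT0]
  · filter_upwards [isOpen_ball.mem_nhds h0] with z hz
    have h1 := ((hloc.deriv hUd isOpen_ball).tendsto_at hz)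
    have h2 : Tendsto (fun n => f (z, (U n).1 z)) atTop (𝓝 (f (z, u z))) :=
      ((hRs _ (hmem u huS z hz)).1.continuousAt.tendsto).comp
        (tendsto_const_nhds.prodMk_nhds (hu z hz))
    have h3 : deriv u z = f (z, u z) := by
      refine tendsto_nhds_unique ((tendsto_add_atTop_iff_nat 1).2 h1) (h2.congr fun n => ?_)
      simp only [Function.comp, hU, (hT (U n) z hz).deriv]
    rw [← h3]
    exact (hud.differentiableAt (isOpen_ball.mem_nhds hz)).hasDerivAt

end

section

variable {E : Type*} [NormedAddCommGroup E] [NormedSpace ℂ E]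
  {X : Type*} [TopologicalSpace X] [ChartedSpace E X] [IsManifold 𝓘(ℂ, E) ω X]

namespace TimeDependentVectorField

/-- `A`, as a vector field on the product `X × ℂ` whose component along `ℂ` is zero. -/
def vertical (A : TimeDependentVectorField E X) (p : X × ℂ) :
    TangentSpace (𝓘(ℂ, E).prod 𝓘(ℂ, ℂ)) p :=
  ((A.toFun p.2 p.1, 0) : E × ℂ)

/-- The vector field `D(A) = ∂/∂t + A` on `X × ℂ`. -/
def flowField (A : TimeDependentVectorField E X) (p : X × ℂ) :
    TangentSpace (𝓘(ℂ, E).prod 𝓘(ℂ, ℂ)) p :=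
  ((A.toFun p.2 p.1, 1) : E × ℂ)

/-- The iterated Lie derivative `(L_{D(A)})^m A`, a vector field on `X × ℂ`. -/
noncomputable def lieIterate (A : TimeDependentVectorField E X) (m : ℕ) :
    ∀ p : X × ℂ, TangentSpace (𝓘(ℂ, E).prod 𝓘(ℂ, ℂ)) p :=
  (fun W => mlieBracket (𝓘(ℂ, E).prod 𝓘(ℂ, ℂ)) A.flowField W)^[m] A.vertical

/-- `A` is a time-dependent vector field in `F`: a finite sum `∑ tⁱ Aᵢ` with all `Aᵢ` global
sections of `F`. -/
def InSheaf (A : TimeDependentVectorField E X) (F : LieSubsheaf E X) : Prop :=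
  ∃ (N : ℕ) (a : ℕ → ∀ x : X, TangentSpace 𝓘(ℂ, E) x), (∀ i, F.IsSection ⊤ (a i)) ∧
    ∀ (t : ℂ) (x : X), A.toFun t x = ∑ i ∈ Finset.range N, t ^ i • a i x

/-- `γ` is the integral curve of `A` through `x`: `γ(0) = x` and `γ'(t) = A_t(γ(t))` for all `t`
near `0`. -/
def IsIntegralCurve (A : TimeDependentVectorField E X) {x : X} (γ : HolCurve E x) : Prop :=
  ∀ᶠ t in 𝓝 (0 : ℂ), HasMFDerivAt 𝓘(ℂ, ℂ) 𝓘(ℂ, E) γ.toFun t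
    ((1 : ℂ →L[ℂ] ℂ).smulRight (A.toFun t (γ.toFun t)))

end TimeDependentVectorField

/-- The restriction `W_0` to time `t = 0` of a vector field `W` on `X × ℂ`, projected to `X`. (The
fields `(L_{D(A)})^m A` have no component along `ℂ`, so nothing is lost.) -/
def atTimeZero (W : ∀ p : X × ℂ, TangentSpace (𝓘(ℂ, E).prod 𝓘(ℂ, ℂ)) p) (x : X) :
    TangentSpace 𝓘(ℂ, E) x :=
  (W (x, 0) : E × ℂ).1

/-- Integral curves exist. -/
theorem TimeDependentVectorField.exists_isIntegralCurve [FiniteDimensional ℂ E]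
    (A : TimeDependentVectorField E X) (x : X) :
    ∃ γ : HolCurve E x, A.IsIntegralCurve γ := by
  have : CompleteSpace E := FiniteDimensional.complete ℂ E
  set φ := extChartAt 𝓘(ℂ, E) x with hφ
  have hx : x ∈ φ.source := mem_extChartAt_source x
  have hφx : φ x ∈ φ.target := mem_extChartAt_target x
  let f : ℂ × E → E := fun p =>
    tangentCoordChange 𝓘(ℂ, E) (φ.symm p.2) x (φ.symm p.2) (A.toFun p.1 (φ.symm p.2))
  have hf : ContDiffAt ℂ ω f (0, φ x) := by
    have h1 := (Bundle.contMDiffAt_totalSpace.1 (A.holomorphic (x, 0))).2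
    have hsymm : ContMDiffAt 𝓘(ℂ, E) 𝓘(ℂ, E) ω φ.symm (φ x) :=
      (contMDiffOn_extChartAt_symm x).contMDiffAt (extChartAt_target_mem_nhds x)
    have h2 : ContMDiffAt 𝓘(ℂ, ℂ × E) (𝓘(ℂ, E).prod 𝓘(ℂ, ℂ)) ω
        (fun p : ℂ × E => (φ.symm p.2, p.1)) (0, φ x) :=
      ContMDiffAt.prodMk
        (hsymm.comp (x := ((0 : ℂ), φ x)) (f := Prod.snd) (contDiffAt_snd.contMDiffAt))
        contDiffAt_fst.contMDiffAt
    have h3 : (x, (0 : ℂ)) = (fun p : ℂ × E => (φ.symm p.2, p.1)) (0, φ x) := by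
      simp [hφ]
    rw [h3] at h1
    have h4 := (h1.comp (x := ((0 : ℂ), φ x)) h2).contDiffAt
    refine h4.congr_of_eventuallyEq (Eventually.of_forall fun p => ?_)
    simp only [f, Function.comp, TangentBundle.trivializationAt_apply, hφ,
      extChartAt_to_inv]
    rfl
  obtain ⟨u, hu0, hu⟩ := exists_holomorphic_solution f (φ x) (hf.of_le le_top)
  have hud : ∀ᶠ t in 𝓝 (0 : ℂ), DifferentiableAt ℂ u t := hu.mono fun t h => h.differentiableAt
  have huan : ContDiffAt ℂ ω u 0 :=
    (Complex.analyticAt_iff_eventually_differentiableAt.2 hud).contDiffAt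
  have hut : ∀ᶠ t in 𝓝 (0 : ℂ), u t ∈ φ.target := by
    refine huan.continuousAt.eventually_mem ?_
    rw [hu0]
    exact extChartAt_target_mem_nhds x
  have hsymm0 : ContMDiffAt 𝓘(ℂ, E) 𝓘(ℂ, E) ω φ.symm (u 0) := by
    rw [hu0]
    exact (contMDiffOn_extChartAt_symm x).contMDiffAt (extChartAt_target_mem_nhds x)
  refine ⟨⟨fun t => φ.symm (u t), by simp [hu0, hφ], hsymm0.comp 0 huan.contMDiffAt⟩, ?_⟩
  filter_upwards [hu, hut] with t ht htt
  change HasMFDerivAt 𝓘(ℂ, ℂ) 𝓘(ℂ, E) (φ.symm ∘ u) t _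
  set y : X := φ.symm (u t) with hy
  have hyx : y ∈ φ.source := φ.map_target htt
  have hyy : y ∈ (extChartAt 𝓘(ℂ, E) y).source := mem_extChartAt_source y
  refine ⟨(continuousAt_extChartAt_symm'' htt).comp ht.continuousAt, ?_⟩
  have h := hasFDerivWithinAt_tangentCoordChange (I := 𝓘(ℂ, E)) (x := x) (y := y) (z := y)
    ⟨hyx, hyy⟩
  rw [← hφ, hy, φ.right_inv htt, ← hy] at h
  simp only [modelWithCornersSelf_coe, range_id, hasFDerivWithinAt_univ] at h
  have h' := h.comp_hasDerivAt t ht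
  have e : tangentCoordChange 𝓘(ℂ, E) x y y (f (t, u t)) = A.toFun t y :=
    (tangentCoordChange_comp ⟨⟨hyy, hyx⟩, hyy⟩).trans (tangentCoordChange_self hyy)
  rw [e] at h'
  exact h'.hasFDerivAt.hasFDerivWithinAt

/-- `τ^n_A(x)`: the `n`-th order jet at `x` of the `A`-integral curve through `x`. -/
noncomputable def inducedJet [FiniteDimensional ℂ E] (A : TimeDependentVectorField E X) (n : ℕ)
    (x : X) :
    Jet E n x :=
  Quotient.mk (jetSetoid E n x) (A.exists_isIntegralCurve x).choose

/-- `A` is a time-dependent vector field in `F` which is `n`-admissible for `G`: for `1 ≤ m ≤ n`,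
the restriction to `Y` of `(L_{D(A)})^m A` at time `t = 0` is a section of `G`. -/
structure IsAdmissible (F : LieSubsheaf E X) {Y : Set X}
    (G : AbelianSubsheaf (fun y : Y => TangentSpace 𝓘(ℂ, E) (y : X))) (n : ℕ)
    (A : TimeDependentVectorField E X) : Prop where
  inSheaf : A.InSheaf F
  lie_mem : ∀ m, 1 ≤ m → m ≤ n →
    G.IsSection ⊤ (fun y => atTimeZero (A.lieIterate m) (y : X))

end

end JetDeformation

/-!
Write `C = B - A` and `L_A = ∂/∂t + ad A`, a derivation of the Lie algebra of time-dependent vector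
fields in `F`. The proof combines an analytic fact, pointwise on `Y`, with an algebraic one.

*Analysis* (`lieDeriv_iterate_eq_jet_diff`). If the integral curves `u` of `A` and `v` of `B` through
`y` agree to order `n`, then `(L_A ^ k C)_0` vanishes at `y` for `k < n`, and `(L_A ^ n C)_0 (y)` is
the difference of the jets of order `n + 1`. In a chart, `v' - u'` and `C` along `u` differ by a term
of order `t ^ (n + 1)`, and if `w_k` denotes the field `L_A ^ k C` along `u`, then
`w_(k+1) = w_k' - (D A) w_k`, so that each application of `L_A` lowers the order of vanishing by one
and acts on the leading coefficient as `d/dt` does (`lieDerivative_eq_iteratedDeriv_sub`). No flow is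
needed.

*Algebra* (`ev_iterate_lieDeriv_sub_mem`). As `L_B = L_A + ad C`, the difference
`L_B ^ n B - L_A ^ n B` is a sum of terms `L_A ^ i [C, W]` with `i < n`, which at `t = 0` expand by
the Leibniz rule into brackets of the fields `(L_A ^ l C)_0`, `l < n`, with fields in `F`. These
fields vanish along `Y`, hence the brackets restrict to sections of the obstruction sheaf `G`.
So does `(L_A ^ n C)_0 = (L_A ^ n B)_0 - (L_A ^ n A)_0`, by admissibility of `A` and `B` for `m = n`.

Time-dependent vector fields in `F` are modelled by the Lie algebra `ℂ[X] ⊗ H⁰(X, F)`; the bracket on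
`X × ℂ` that defines `lieIterate` is identified with `∂/∂t + ad A` by a computation in a chart
(`mlieBracket_suspension`).
-/

namespace JetDeformation

/-! ### Derivations `d + ad a` of a Lie ring -/

section LieDerivative

variable {V : Type*} [LieRing V]

/-- The operator `d + ad a` on a Lie ring `V` with an additive endomorphism `d`. -/
def lieDeriv (d : V →+ V) (a : V) : V →+ V where
  toFun w := d w + ⁅a, w⁆
  map_zero' := by simp
  map_add' v w := by rw [map_add, lie_add]; abel

lemma lieDeriv_apply (d : V →+ V) (a w : V) : lieDeriv d a w = d w + ⁅a, w⁆ := rfl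

lemma lieDeriv_lie {d : V →+ V} (hd : ∀ v w, d ⁅v, w⁆ = ⁅d v, w⁆ + ⁅v, d w⁆) (a v w : V) :
    lieDeriv d a ⁅v, w⁆ = ⁅lieDeriv d a v, w⁆ + ⁅v, lieDeriv d a w⁆ := by
  simp only [lieDeriv_apply, hd, leibniz_lie a v w, add_lie, lie_add]
  abel

variable {g : Type*} [LieRing g] {ev : V →+ g} {d : V →+ V} {Z : Set g} {H : AddSubgroup g}

/-- By the Leibniz rule, `(d + ad a)^i ⁅c, w⁆` is a sum of brackets of `(d + ad a)^l c`, `l ≤ i`, with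
other elements. -/
lemma ev_iterate_lieDeriv_lie_mem (hev : ∀ v w, ev ⁅v, w⁆ = ⁅ev v, ev w⁆)
    (hd : ∀ v w, d ⁅v, w⁆ = ⁅d v, w⁆ + ⁅v, d w⁆) (hZH : ∀ z ∈ Z, ∀ w, ⁅z, w⁆ ∈ H) (a : V)
    {i : ℕ} : ∀ {c : V} (w : V), (∀ l ≤ i, ev ((lieDeriv d a)^[l] c) ∈ Z) →
      ev ((lieDeriv d a)^[i] ⁅c, w⁆) ∈ H := by
  induction i with
  | zero =>
    intro c w hc
    simpa [hev] using hZH _ (hc 0 le_rfl) (ev w)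
  | succ i ih =>
    intro c w hc
    rw [Function.iterate_succ_apply, lieDeriv_lie hd, iterate_map_add, map_add]
    exact H.add_mem (ih w fun l hl => hc (l + 1) (by lia)) (ih _ fun l hl => hc l (by lia))

/-- The algebraic core: if the `(d + ad a)^k (b - a)`, `k < n`, are sent by `ev` into a set `Z` whose
brackets with all elements lie in `H`, then replacing `d + ad b` by `d + ad a` in `(d + ad b)^n b`
changes the image under `ev` by an element of `H`. -/
lemma ev_iterate_lieDeriv_sub_mem (hev : ∀ v w, ev ⁅v, w⁆ = ⁅ev v, ev w⁆)
    (hd : ∀ v w, d ⁅v, w⁆ = ⁅d v, w⁆ + ⁅v, d w⁆) (hZH : ∀ z ∈ Z, ∀ w, ⁅z, w⁆ ∈ H) {a b : V}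
    {n : ℕ} (hZ : ∀ k < n, ev ((lieDeriv d a)^[k] (b - a)) ∈ Z)
    (ha : ev ((lieDeriv d a)^[n] a) ∈ H) (hb : ev ((lieDeriv d b)^[n] b) ∈ H) :
    ev ((lieDeriv d a)^[n] (b - a)) ∈ H := by
  -- replace the factors `d + ad b` by `d + ad a` one at a time, the outermost one first
  have key : ∀ m i, i + m ≤ n →
      ev ((lieDeriv d a)^[i] ((lieDeriv d b)^[m] b)) - ev ((lieDeriv d a)^[i + m] b) ∈ H := by
    intro m
    induction m with
    | zero => intro i _; simp
    | succ m ih =>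
      intro i hi
      set x := (lieDeriv d b)^[m] b with hx
      have h1 : lieDeriv d b x = lieDeriv d a x + ⁅b - a, x⁆ := by
        simp only [lieDeriv_apply, sub_lie]; abel
      rw [Function.iterate_succ_apply', ← hx, h1, iterate_map_add, map_add,
        ← Function.iterate_succ_apply, add_sub_right_comm, ← add_assoc, add_right_comm i m 1]
      exact H.add_mem (ih (i + 1) (by lia))
        (ev_iterate_lieDeriv_lie_mem hev hd hZH a x fun l hl => hZ l (by lia))
  have h := key n 0 (by simp)
  rw [Function.iterate_zero_apply, zero_add] at h
  rw [iterate_map_sub, map_sub]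
  have := H.sub_mem (H.sub_mem hb h) ha
  simpa using this

end LieDerivative

/-! ### Taylor expansion of solutions of holomorphic differential equations -/

section Taylor

open Filter

variable {E : Type*} [NormedAddCommGroup E] [NormedSpace ℂ E]

lemma deriv_eventuallyEq_pow_smul {f g : ℂ → E} {n : ℕ}
    (hg : ∀ᶠ t in 𝓝 (0 : ℂ), DifferentiableAt ℂ g t)
    (h : f =ᶠ[𝓝 0] fun t => t ^ (n + 1) • g t) :
    deriv f =ᶠ[𝓝 0] fun t => t ^ n • (((n + 1 : ℕ) : ℂ) • g t + t • deriv g t) := by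
  filter_upwards [h.eventually_nhds, hg] with t ht hgt
  rw [EventuallyEq.deriv_eq ht]
  have := ((hasDerivAt_pow (n + 1) t).smul hgt.hasDerivAt).deriv
  refine Eq.trans this ?_
  simp only [Nat.add_sub_cancel]
  module

variable [CompleteSpace E]

lemma iteratedDeriv_eq_of_eventuallyEq_pow_smul {n : ℕ} : ∀ {f g : ℂ → E}, AnalyticAt ℂ g 0 →
    (f =ᶠ[𝓝 0] fun t => t ^ n • g t) → iteratedDeriv n f 0 = (n.factorial : ℂ) • g 0 := by
  induction n with
  | zero =>
    intro f g _ h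
    simpa using h.self_of_nhds
  | succ n ih =>
    intro f g hg h
    rw [iteratedDeriv_succ', ih (g := fun t => ((n + 1 : ℕ) : ℂ) • g t + t • deriv g t) ?_
      (deriv_eventuallyEq_pow_smul (hg.eventually_analyticAt.mono fun t h => h.differentiableAt) h)]
    · simp only [zero_smul, add_zero, smul_smul, Nat.factorial_succ]
      push_cast
      ring_nf
    · have := hg.deriv
      fun_prop

omit [CompleteSpace E] in
/-- An analytic function that is `O(t ^ m)` is divisible by `t ^ m`. -/
lemma exists_eq_pow_smul_of_isBigO {f : ℂ → E} {m : ℕ} (hf : AnalyticAt ℂ f 0)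
    (h : f =O[𝓝 0] fun t => t ^ m) :
    ∃ g, AnalyticAt ℂ g 0 ∧ f =ᶠ[𝓝 0] fun t => t ^ m • g t := by
  suffices H : ∀ k ≤ m, ∃ g, AnalyticAt ℂ g 0 ∧ f =ᶠ[𝓝 0] fun t => t ^ k • g t from H m le_rfl
  intro k
  induction k with
  | zero => exact fun _ => ⟨f, hf, by simp⟩
  | succ k ih =>
    intro hk
    obtain ⟨g, hg, hfg⟩ := ih (by lia)
    have hg0 : g 0 = 0 := by
      have h1 : g =O[𝓝[≠] 0] fun t : ℂ => t ^ (m - k) := by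
        have h2 : (fun t : ℂ => (t ^ k)⁻¹ • f t) =O[𝓝[≠] 0] fun t => (t ^ k)⁻¹ • t ^ m :=
          (Asymptotics.isBigO_refl _ _).smul (h.mono nhdsWithin_le_nhds)
        refine (h2.congr' ?_ ?_)
        · filter_upwards [hfg.filter_mono nhdsWithin_le_nhds, self_mem_nhdsWithin] with t ht ht0
          rw [ht, smul_smul, inv_mul_cancel₀ (pow_ne_zero _ ht0), one_smul]
        · filter_upwards [self_mem_nhdsWithin] with t ht0
          rw [pow_sub₀ _ ht0 (by lia), smul_eq_mul, mul_comm]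
      have h3 : Tendsto (fun t : ℂ => t ^ (m - k)) (𝓝[≠] 0) (𝓝 0) := by
        have : Tendsto (fun t : ℂ => t ^ (m - k)) (𝓝 0) (𝓝 (0 ^ (m - k))) :=
          (continuous_pow (m - k)).tendsto 0
        rw [zero_pow (by lia)] at this
        exact this.mono_left nhdsWithin_le_nhds
      exact tendsto_nhds_unique (hg.continuousAt.tendsto.mono_left nhdsWithin_le_nhds)
        (h1.trans_tendsto h3)
    have h4 : ((1 : ℕ) : ℕ∞) ≤ analyticOrderAt g 0 := by
      rw [Nat.cast_one, Order.one_le_iff_ne_zero]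
      exact analyticOrderAt_ne_zero.2 ⟨hg, hg0⟩
    obtain ⟨g', hg', h5⟩ := (natCast_le_analyticOrderAt hg).1 h4
    refine ⟨g', hg', ?_⟩
    filter_upwards [hfg, h5] with t h6 h7
    rw [h6, h7, smul_smul, sub_zero, pow_one, pow_succ]

/-- Let `u` and `v` be solutions of `u' = f (t, u)` and `v' = g (t, v)` which agree to order `n` at
`0`, and let `w k` be the `k`-th Lie derivative of `g - f` along `∂/∂t + f`. Then `w k` vanishes at
the initial point for `k < n`, and `w n` is the difference of the `(n + 1)`-st derivatives there. -/
theorem lieDerivative_eq_iteratedDeriv_sub {f g : ℂ × E → E} {e : E} {u v : ℂ → E}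
    (hf : AnalyticAt ℂ f (0, e)) (hg : AnalyticAt ℂ g (0, e))
    (hu : AnalyticAt ℂ u 0) (hv : AnalyticAt ℂ v 0) (hu0 : u 0 = e)
    (hu' : ∀ᶠ t in 𝓝 (0 : ℂ), HasDerivAt u (f (t, u t)) t)
    (hv' : ∀ᶠ t in 𝓝 (0 : ℂ), HasDerivAt v (g (t, v t)) t)
    {n : ℕ} (huv : ∀ k ≤ n, iteratedDeriv k u 0 = iteratedDeriv k v 0)
    {w : ℕ → ℂ × E → E} (hw0 : w 0 =ᶠ[𝓝 (0, e)] fun p => g p - f p)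
    (hw : ∀ k, AnalyticAt ℂ (w k) (0, e))
    (hws : ∀ k, w (k + 1) =ᶠ[𝓝 (0, e)]
      fun p => fderiv ℂ (w k) p (1, f p) - fderiv ℂ f p (0, w k p)) :
    (∀ k < n, w k (0, e) = 0) ∧
      w n (0, e) = iteratedDeriv (n + 1) v 0 - iteratedDeriv (n + 1) u 0 := by
  have hv0 : v 0 = e := by simpa [hu0] using (huv 0 (Nat.zero_le n)).symm
  have hU : AnalyticAt ℂ (fun t => (t, u t)) 0 := analyticAt_id.prod hu
  have hV : AnalyticAt ℂ (fun t => (t, v t)) 0 := analyticAt_id.prod hv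
  have hU0 : Tendsto (fun t => (t, u t)) (𝓝 0) (𝓝 ((0 : ℂ), e)) := by
    simpa [ContinuousAt, hu0] using hU.continuousAt
  have hV0 : Tendsto (fun t => (t, v t)) (𝓝 0) (𝓝 ((0 : ℂ), e)) := by
    simpa [ContinuousAt, hv0] using hV.continuousAt
  -- the two solutions differ by `t ^ (n + 1) • h`
  obtain ⟨h, hh, hvu⟩ : ∃ h, AnalyticAt ℂ h 0 ∧
      (fun t => v t - u t) =ᶠ[𝓝 0] fun t => t ^ (n + 1) • h t := by
    have h1 : ((n + 1 : ℕ) : ℕ∞) ≤ analyticOrderAt (v - u) 0 := by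
      rw [natCast_le_analyticOrderAt_iff_iteratedDeriv_eq_zero (hv.sub hu)]
      intro i hi
      rw [iteratedDeriv_sub hv.contDiffAt hu.contDiffAt, huv i (by lia), sub_self]
    obtain ⟨h, hh, h2⟩ := (natCast_le_analyticOrderAt (hv.sub hu)).1 h1
    exact ⟨h, hh, by simpa [EventuallyEq] using h2⟩
  have hh' : ∀ᶠ t in 𝓝 (0 : ℂ), DifferentiableAt ℂ h t :=
    hh.eventually_analyticAt.mono fun t h => h.differentiableAt
  -- hence so do the values of `g` along the two solutions
  obtain ⟨r, hr, hgr⟩ : ∃ r, AnalyticAt ℂ r 0 ∧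
      (fun t => g (t, v t) - g (t, u t)) =ᶠ[𝓝 0] fun t => t ^ (n + 1) • r t := by
    apply exists_eq_pow_smul_of_isBigO
    · exact (hg.comp_of_eq hV (by simp [hv0])).sub (hg.comp_of_eq hU (by simp [hu0]))
    · obtain ⟨K, s, hs, hK⟩ := (hg.contDiffAt (n := 1)).exists_lipschitzOnWith
      have h1 : (fun t => g (t, v t) - g (t, u t)) =O[𝓝 0] fun t => v t - u t := by
        refine Asymptotics.IsBigO.of_bound K ?_
        filter_upwards [hU0 hs, hV0 hs] with t h2 h3
        simpa [Prod.norm_def] using hK.norm_sub_le h3 h2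
      refine (h1.congr' EventuallyEq.rfl hvu).trans ?_
      simpa using (Asymptotics.isBigO_refl (fun t : ℂ => t ^ (n + 1)) (𝓝 0)).smul
        (hh.continuousAt.isBigO_one ℂ)
  -- `w k` along `u` is divisible by `t ^ (n - k)`, and its `(n - k)`-th derivative at `0` does not
  -- depend on `k`
  have key : ∀ k ≤ n, ∃ ρ, AnalyticAt ℂ ρ 0 ∧
      (fun t => w k (t, u t)) =ᶠ[𝓝 0] (fun t => t ^ (n - k) • ρ t) ∧
      ((n - k).factorial : ℂ) • ρ 0 = ((n + 1).factorial : ℂ) • h 0 := by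
    intro k
    induction k with
    | zero =>
      intro _
      refine ⟨fun t => ((n + 1 : ℕ) : ℂ) • h t + t • (deriv h t - r t), ?_, ?_, ?_⟩
      · have := hh.deriv
        fun_prop
      · filter_upwards [hU0.eventually hw0, hu', hv', hgr,
          deriv_eventuallyEq_pow_smul hh' hvu] with t h1 h2 h3 h4 h5
        rw [(h3.fun_sub h2).deriv] at h5
        rw [h1, Nat.sub_zero]
        have : g (t, u t) - f (t, u t)
            = (g (t, v t) - f (t, u t)) - (g (t, v t) - g (t, u t)) := by abel
        rw [this, h4, h5]
        module
      · simp only [Nat.sub_zero, zero_smul, add_zero, smul_smul, Nat.factorial_succ]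
        push_cast
        ring_nf
    | succ k ih =>
      intro hk
      obtain ⟨ρ, hρ, h1, h2⟩ := ih (by lia)
      obtain ⟨m, hm⟩ : ∃ m, n - k = m + 1 := ⟨n - k - 1, by lia⟩
      have hm' : n - (k + 1) = m := by lia
      rw [hm] at h1 h2
      rw [hm']
      have hρ' : ∀ᶠ t in 𝓝 (0 : ℂ), DifferentiableAt ℂ ρ t :=
        hρ.eventually_analyticAt.mono fun t h => h.differentiableAt
      refine ⟨fun t => ((m + 1 : ℕ) : ℂ) • ρ t
        + t • (deriv ρ t - fderiv ℂ f (t, u t) (0, ρ t)), ?_, ?_, ?_⟩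
      · have h3 := hρ.deriv
        have h4 : AnalyticAt ℂ (fun t => fderiv ℂ f (t, u t)) 0 :=
          hf.fderiv.comp_of_eq hU (by simp [hu0])
        have h5 : AnalyticAt ℂ (fun t => fderiv ℂ f (t, u t) ((0 : ℂ), ρ t)) 0 :=
          ContDiffAt.analyticAt
            (h4.contDiffAt.clm_apply (analyticAt_const.prod hρ).contDiffAt)
        fun_prop
      · filter_upwards [hU0.eventually (hws k), hu', h1, deriv_eventuallyEq_pow_smul hρ' h1,
          hU0.eventually (hw k).eventually_analyticAt] with t h3 h4 h5 h6 h7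
        have h8 : HasDerivAt (fun t => w k (t, u t)) (fderiv ℂ (w k) (t, u t) (1, f (t, u t))) t :=
          h7.differentiableAt.hasFDerivAt.comp_hasDerivAt t ((hasDerivAt_id t).prodMk h4)
        rw [h8.deriv] at h6
        have h9 : ((0 : ℂ), t ^ (m + 1) • ρ t) = t ^ (m + 1) • ((0 : ℂ), ρ t) := by simp
        rw [h3, h5, h6, h9, map_smul]
        module
      · rw [← h2]
        simp only [zero_smul, add_zero, smul_smul, Nat.factorial_succ]
        push_cast
        ring_nf
  refine ⟨fun k hk => ?_, ?_⟩
  · obtain ⟨ρ, -, h1, -⟩ := key k hk.le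
    have := h1.self_of_nhds
    simpa [hu0, zero_pow (Nat.sub_ne_zero_of_lt hk)] using this
  · obtain ⟨ρ, -, h1, h2⟩ := key n le_rfl
    have h3 := h1.self_of_nhds
    simp only [hu0, Nat.sub_self, pow_zero, one_smul, Nat.factorial_zero, Nat.cast_one] at h2 h3
    rw [h3, h2, ← iteratedDeriv_eq_of_eventuallyEq_pow_smul hh hvu,
      iteratedDeriv_fun_sub hv.contDiffAt hu.contDiffAt]

end Taylor

/-! ### Polynomials with coefficients in a Lie algebra -/

section PolynomialPaths

open TensorProduct Polynomial

variable {L : Type*} [LieRing L] [LieAlgebra ℂ L]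

/-- Evaluation at `t` of a polynomial with coefficients in `L`. -/
noncomputable def polyEval (t : ℂ) : ℂ[X] ⊗[ℂ] L →ₗ[ℂ] L :=
  TensorProduct.lid ℂ L ∘ₗ (Polynomial.aeval t : ℂ[X] →ₐ[ℂ] ℂ).toLinearMap.rTensor L

@[simp] lemma polyEval_tmul (t : ℂ) (p : ℂ[X]) (a : L) :
    polyEval t (p ⊗ₜ[ℂ] a) = p.eval t • a := by
  simp [polyEval, Polynomial.aeval_def, Polynomial.eval₂_eq_eval_map]

-- Elaboration finds a bracket on the tensor product that agrees with the one of its Lie ring structure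
-- only after unfolding, so that `add_lie` and the like do not rewrite it.
lemma tensor_add_lie (v v' w : ℂ[X] ⊗[ℂ] L) : ⁅v + v', w⁆ = ⁅v, w⁆ + ⁅v', w⁆ := add_lie v v' w

lemma tensor_lie_add (v w w' : ℂ[X] ⊗[ℂ] L) : ⁅v, w + w'⁆ = ⁅v, w⁆ + ⁅v, w'⁆ := lie_add v w w'

lemma tensor_zero_lie (w : ℂ[X] ⊗[ℂ] L) : ⁅(0 : ℂ[X] ⊗[ℂ] L), w⁆ = 0 := zero_lie w

lemma tensor_lie_zero (v : ℂ[X] ⊗[ℂ] L) : ⁅v, (0 : ℂ[X] ⊗[ℂ] L)⁆ = 0 := lie_zero v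

lemma polyEval_lie (t : ℂ) (v w : ℂ[X] ⊗[ℂ] L) :
    polyEval t ⁅v, w⁆ = ⁅polyEval t v, polyEval t w⁆ := by
  induction v with
  | zero => simp [tensor_zero_lie]
  | add v v' hv hv' => simp only [tensor_add_lie, map_add, hv, hv', add_lie]
  | tmul p a =>
    induction w with
    | zero => simp [tensor_lie_zero]
    | add w w' hw hw' => simp only [tensor_lie_add, map_add, hw, hw', lie_add]
    | tmul q b => simp [smul_smul, mul_comm]

/-- The derivative with respect to the variable of a polynomial with coefficients in `L`. -/
noncomputable def polyDeriv : ℂ[X] ⊗[ℂ] L →ₗ[ℂ] ℂ[X] ⊗[ℂ] L :=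
  (Polynomial.derivative : ℂ[X] →ₗ[ℂ] ℂ[X]).rTensor L

@[simp] lemma polyDeriv_tmul (p : ℂ[X]) (a : L) :
    polyDeriv (p ⊗ₜ[ℂ] a) = Polynomial.derivative p ⊗ₜ[ℂ] a := rfl

lemma polyDeriv_lie (v w : ℂ[X] ⊗[ℂ] L) :
    polyDeriv ⁅v, w⁆ = ⁅polyDeriv v, w⁆ + ⁅v, polyDeriv w⁆ := by
  induction v with
  | zero => simp [tensor_zero_lie]
  | add v v' hv hv' => simp only [tensor_add_lie, map_add, hv, hv']; abel
  | tmul p a =>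
    induction w with
    | zero => simp [tensor_lie_zero]
    | add w w' hw hw' => simp only [tensor_lie_add, map_add, hw, hw']; abel
    | tmul q b => simp [TensorProduct.add_tmul]

end PolynomialPaths

/-! ### The Lie algebra of global sections -/

section GlobalSections

open VectorField

variable {E : Type*} [NormedAddCommGroup E] [NormedSpace ℂ E]
  {X : Type*} [TopologicalSpace X] [ChartedSpace E X] [IsManifold 𝓘(ℂ, E) ω X]

/-- The complex vector space `H⁰(X, F)`. -/
def globalSections (F : LieSubsheaf E X) : Submodule ℂ (∀ x : X, TangentSpace 𝓘(ℂ, E) x) where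
  carrier := {A | F.IsSection ⊤ A}
  zero_mem' := F.zero_mem ⊤
  add_mem' := F.add_mem
  smul_mem' c _ h := F.smul_mem c h

variable {F : LieSubsheaf E X}

lemma contMDiff_globalSections (a : globalSections F) : ContMDiff 𝓘(ℂ, E) 𝓘(ℂ, E).tangent ω
    (fun x => (⟨x, a.1 x⟩ : TangentBundle 𝓘(ℂ, E) X)) :=
  contMDiffOn_univ.1 (F.holomorphic a.2)

lemma mdifferentiable_globalSections (a : globalSections F) :
    MDifferentiable 𝓘(ℂ, E) 𝓘(ℂ, E).tangent
      (fun x => (⟨x, a.1 x⟩ : TangentBundle 𝓘(ℂ, E) X)) :=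
  (contMDiff_globalSections a).mdifferentiable (by simp)

noncomputable instance : Bracket (globalSections F) (globalSections F) where
  bracket a b := ⟨mlieBracket 𝓘(ℂ, E) a.1 b.1, F.lie_mem a.2 b.2⟩

lemma coe_lie (a b : globalSections F) :
    (⁅a, b⁆ : globalSections F).1 = mlieBracket 𝓘(ℂ, E) a.1 b.1 := rfl

variable [CompleteSpace E]

noncomputable instance : LieRing (globalSections F) where
  add_lie a b c := by
    ext1; funext x
    exact mlieBracket_add_left (mdifferentiable_globalSections a x)
      (mdifferentiable_globalSections b x)
  lie_add a b c := by
    ext1; funext x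
    exact mlieBracket_add_right (mdifferentiable_globalSections b x)
      (mdifferentiable_globalSections c x)
  lie_self a := by
    ext1
    exact mlieBracket_self
  leibniz_lie a b c := by
    ext1; funext x
    have : IsManifold 𝓘(ℂ, E) (minSmoothness ℂ 3) X := .of_le (n := ω) le_top
    exact leibniz_identity_mlieBracket_apply ((contMDiff_globalSections a x).of_le le_top)
      ((contMDiff_globalSections b x).of_le le_top) ((contMDiff_globalSections c x).of_le le_top)

noncomputable instance : LieAlgebra ℂ (globalSections F) where
  lie_smul c a b := by
    ext1; funext x
    exact mlieBracket_const_smul_right (mdifferentiable_globalSections b x)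

end GlobalSections

/-! ### Vector fields in a chart -/

section Chart

open VectorField Filter TensorProduct Polynomial

variable {E : Type*} [NormedAddCommGroup E] [NormedSpace ℂ E]
  {X : Type*} [TopologicalSpace X] [ChartedSpace E X]

/-- The vector field `V`, read in the preferred chart at `y`: its pullback under the inverse of the
chart, meaningful only on the target of the chart. -/
noncomputable def chartField (y : X) (V : ∀ x : X, TangentSpace 𝓘(ℂ, E) x) : E → E :=
  mpullback 𝓘(ℂ, E) 𝓘(ℂ, E) (extChartAt 𝓘(ℂ, E) y).symm V

lemma chartField_apply (y : X) (V : ∀ x : X, TangentSpace 𝓘(ℂ, E) x) (e : E) :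
    chartField y V e = (mfderiv 𝓘(ℂ, E) 𝓘(ℂ, E) (extChartAt 𝓘(ℂ, E) y).symm e).inverse
      (V ((extChartAt 𝓘(ℂ, E) y).symm e)) := rfl

lemma chartField_add (y : X) (V W : ∀ x : X, TangentSpace 𝓘(ℂ, E) x) :
    chartField y (V + W) = chartField y V + chartField y W := by
  ext e
  exact mpullback_add_apply

lemma chartField_smul (y : X) (c : ℂ) (V : ∀ x : X, TangentSpace 𝓘(ℂ, E) x) :
    chartField y (c • V) = c • chartField y V := by
  ext e
  exact mpullback_const_smul_apply

variable [IsManifold 𝓘(ℂ, E) ω X] {F : LieSubsheaf E X}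

lemma isInvertible_mfderiv_extChartAt_symm {y : X} {e : E}
    (he : e ∈ (extChartAt 𝓘(ℂ, E) y).target) :
    (mfderiv 𝓘(ℂ, E) 𝓘(ℂ, E) (extChartAt 𝓘(ℂ, E) y).symm e).IsInvertible := by
  have := isInvertible_mfderivWithin_extChartAt_symm he
  simpa only [modelWithCornersSelf_coe, Set.range_id, mfderivWithin_univ] using this

/-- At the base point the chart induces the identification of `T_X|_y` with `E`. -/
lemma chartField_extChartAt_self (y : X) (V : ∀ x : X, TangentSpace 𝓘(ℂ, E) x) :
    chartField y V (extChartAt 𝓘(ℂ, E) y y) = V y := by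
  rw [chartField_apply]
  have h := mfderivWithin_extChartAt_symm_inverse_apply (I := 𝓘(ℂ, E)) (x := y)
    (V y)
  simp only [modelWithCornersSelf_coe, Set.range_id, mfderivWithin_univ] at h
  rw [extChartAt_to_inv]
  exact h

lemma contMDiffAt_extChartAt_symm {y : X} {e : E} (he : e ∈ (extChartAt 𝓘(ℂ, E) y).target) :
    ContMDiffAt 𝓘(ℂ, E) 𝓘(ℂ, E) ω (extChartAt 𝓘(ℂ, E) y).symm e :=
  (contMDiffOn_extChartAt_symm y).contMDiffAt (extChartAt_target_mem_nhds' he)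

variable [CompleteSpace E]

lemma contDiffAt_chartField {y : X} {e : E} (he : e ∈ (extChartAt 𝓘(ℂ, E) y).target)
    (a : globalSections F) : ContDiffAt ℂ ω (chartField y a.1) e := by
  exact contMDiffAt_vectorSpace_iff_contDiffAt.1 <|
    ContMDiffAt.mpullback_vectorField_preimage (contMDiff_globalSections a _)
    (contMDiffAt_extChartAt_symm he) (isInvertible_mfderiv_extChartAt_symm he) (by simp)

lemma chartField_lie {y : X} {e : E} (he : e ∈ (extChartAt 𝓘(ℂ, E) y).target)
    (a b : globalSections F) :
    chartField y (⁅a, b⁆ : globalSections F).1 e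
      = lieBracket ℂ (chartField y a.1) (chartField y b.1) e := by
  have : IsManifold 𝓘(ℂ, E) (minSmoothness ℂ 2) X := .of_le (n := ω) le_top
  have h := mpullback_mlieBracket (mdifferentiable_globalSections a _)
    (mdifferentiable_globalSections b _) (contMDiffAt_extChartAt_symm he) (by simp)
  rw [← mlieBracketWithin_univ (M := E), mlieBracketWithin_eq_lieBracketWithin] at h
  exact h.trans (congrFun lieBracketWithin_univ e)

/-- The time-dependent vector field defined by a polynomial with coefficients in `H⁰(X, F)`, read in
the preferred chart at `y`, as a function of the time and the position. -/
noncomputable def chartPath (y : X) (w : ℂ[X] ⊗[ℂ] globalSections F) (p : ℂ × E) : E :=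
  chartField y (polyEval p.1 w).1 p.2

lemma chartPath_add (y : X) (v w : ℂ[X] ⊗[ℂ] globalSections F) :
    chartPath y (v + w) = chartPath y v + chartPath y w := by
  ext p
  simp only [chartPath, map_add, Submodule.coe_add, chartField_add, Pi.add_apply]

lemma chartPath_zero (y : X) : chartPath y (0 : ℂ[X] ⊗[ℂ] globalSections F) = 0 := by
  simpa using chartPath_add y (0 : ℂ[X] ⊗[ℂ] globalSections F) 0

lemma chartPath_tmul (y : X) (q : ℂ[X]) (a : globalSections F) :
    chartPath y (q ⊗ₜ[ℂ] a) = fun p => q.eval p.1 • chartField y a.1 p.2 := by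
  ext p
  simp only [chartPath, polyEval_tmul, Submodule.coe_smul, chartField_smul, Pi.smul_apply]

lemma contDiffAt_chartPath {y : X} {p : ℂ × E} (hp : p.2 ∈ (extChartAt 𝓘(ℂ, E) y).target)
    (w : ℂ[X] ⊗[ℂ] globalSections F) : ContDiffAt ℂ ω (chartPath y w) p := by
  induction w with
  | zero => rw [chartPath_zero]; exact contDiffAt_const
  | add v w hv hw => rw [chartPath_add]; exact hv.add hw
  | tmul q a =>
    rw [chartPath_tmul]
    exact ((q.contDiff_aeval ω).contDiffAt.comp p contDiffAt_fst).smul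
      ((contDiffAt_chartField hp a).comp p contDiffAt_snd)

lemma fderiv_chartPath_time {y : X} {p : ℂ × E} (hp : p.2 ∈ (extChartAt 𝓘(ℂ, E) y).target)
    (w : ℂ[X] ⊗[ℂ] globalSections F) :
    fderiv ℂ (chartPath y w) p (1, 0) = chartPath y (polyDeriv w) p := by
  induction w with
  | zero => simp [chartPath_zero]
  | add v w hv hw =>
    rw [chartPath_add, fderiv_add ((contDiffAt_chartPath hp v).differentiableAt (by simp))
      ((contDiffAt_chartPath hp w).differentiableAt (by simp)), map_add, chartPath_add,
      add_apply, hv, hw, Pi.add_apply]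
  | tmul q a =>
    have h1 : HasFDerivAt (fun p : ℂ × E => q.eval p.1) _ p :=
      (q.hasDerivAt p.1).hasFDerivAt.comp p hasFDerivAt_fst
    have h2 : HasFDerivAt (fun p : ℂ × E => chartField y a.1 p.2) _ p :=
      ((contDiffAt_chartField hp a).differentiableAt (by simp)).hasFDerivAt.comp p hasFDerivAt_snd
    rw [chartPath_tmul, (h1.fun_smul h2).fderiv, polyDeriv_tmul, chartPath_tmul]
    simp

lemma fderiv_chartPath_space {y : X} {p : ℂ × E} (hp : p.2 ∈ (extChartAt 𝓘(ℂ, E) y).target)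
    (w : ℂ[X] ⊗[ℂ] globalSections F) (v : E) :
    fderiv ℂ (chartPath y w) p (0, v) = fderiv ℂ (chartField y (polyEval p.1 w).1) p.2 v := by
  have h : HasFDerivAt (fun e => chartPath y w (p.1, e)) _ p.2 :=
    HasFDerivAt.comp (g := chartPath y w) p.2
      ((contDiffAt_chartPath hp w).differentiableAt (by simp)).hasFDerivAt
      (hasFDerivAt_prodMk_right p.1 p.2)
  have h' : fderiv ℂ (chartField y (polyEval p.1 w).1) p.2 = _ := h.fderiv
  rw [h']
  simp

/-- In the preferred chart at `y`, the operator `∂/∂t + ad a` is the Lie derivative along the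
vector field `∂/∂t + a` of vector fields without component in the time direction. -/
lemma chartPath_lieDeriv {y : X} {p : ℂ × E} (hp : p.2 ∈ (extChartAt 𝓘(ℂ, E) y).target)
    (a w : ℂ[X] ⊗[ℂ] globalSections F) :
    chartPath y (lieDeriv polyDeriv.toAddMonoidHom a w) p =
      fderiv ℂ (chartPath y w) p (1, chartPath y a p)
        - fderiv ℂ (chartPath y a) p (0, chartPath y w p) := by
  have h1 : ((1 : ℂ), chartPath y a p) = (1, 0) + (0, chartPath y a p) := by simp
  have h2 : chartPath y ⁅a, w⁆ p = lieBracket ℂ (chartField y (polyEval p.1 a).1)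
      (chartField y (polyEval p.1 w).1) p.2 := by
    rw [← chartField_lie hp, ← polyEval_lie]; rfl
  have h3 : lieDeriv polyDeriv.toAddMonoidHom a w = polyDeriv w + ⁅a, w⁆ := rfl
  rw [h3, chartPath_add, Pi.add_apply, h1, map_add, fderiv_chartPath_space hp,
    fderiv_chartPath_space hp, fderiv_chartPath_time hp, h2, lieBracket_eq]
  simp only [chartPath]
  abel

end Chart

/-! ### The Lie derivative on `X × ℂ` -/

section Product

open VectorField Filter TensorProduct Polynomial

lemma inverse_prod_comp_fst_snd {E : Type*} [NormedAddCommGroup E] [NormedSpace ℂ E]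
    {f : E →L[ℂ] E} (hf : f.IsInvertible) (v : E) (c : ℂ) :
    ((f.comp (ContinuousLinearMap.fst ℂ E ℂ)).prod (ContinuousLinearMap.snd ℂ E ℂ)).inverse (v, c)
      = (f.inverse v, c) := by
  obtain ⟨M, rfl⟩ := hf
  have : ((M : E →L[ℂ] E).comp (ContinuousLinearMap.fst ℂ E ℂ)).prod
      (ContinuousLinearMap.snd ℂ E ℂ) = (M.prodCongr (.refl ℂ ℂ) : E × ℂ →L[ℂ] E × ℂ) := by
    ext <;> simp
  rw [this, ContinuousLinearMap.inverse_equiv, ContinuousLinearMap.inverse_equiv]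
  rfl

variable {E : Type*} [NormedAddCommGroup E] [NormedSpace ℂ E] [CompleteSpace E]
  {X : Type*} [TopologicalSpace X] [ChartedSpace E X] [IsManifold 𝓘(ℂ, E) ω X]
  {F : LieSubsheaf E X}

/-- The vector field `c ∂/∂t + w` on `X × ℂ`, for a polynomial `w` with coefficients in
`H⁰(X, F)`. -/
noncomputable def suspension (c : ℂ) (w : ℂ[X] ⊗[ℂ] globalSections F) (p : X × ℂ) :
    TangentSpace (𝓘(ℂ, E).prod 𝓘(ℂ, ℂ)) p :=
  (((polyEval p.2 w).1 p.1, c) : E × ℂ)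

lemma mpullbackWithin_suspension (p : X × ℂ) {q : E × ℂ}
    (hq : q.1 ∈ (extChartAt 𝓘(ℂ, E) p.1).target) (c : ℂ) (w : ℂ[X] ⊗[ℂ] globalSections F) :
    mpullbackWithin 𝓘(ℂ, E × ℂ) (𝓘(ℂ, E).prod 𝓘(ℂ, ℂ))
      (extChartAt (𝓘(ℂ, E).prod 𝓘(ℂ, ℂ)) p).symm (suspension c w)
      (Set.range (𝓘(ℂ, E).prod 𝓘(ℂ, ℂ))) q = ((chartPath p.1 w (q.2, q.1), c) : E × ℂ) := by
  set φ := extChartAt 𝓘(ℂ, E) p.1 with hφ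
  have hsymm : ((extChartAt (𝓘(ℂ, E).prod 𝓘(ℂ, ℂ)) p).symm : E × ℂ → X × ℂ)
      = fun r => (φ.symm r.1, r.2) := by
    rw [extChartAt_prod]
    rfl
  have h1 : HasMFDerivAt 𝓘(ℂ, E × ℂ) (𝓘(ℂ, E).prod 𝓘(ℂ, ℂ))
      (fun r : E × ℂ => (φ.symm r.1, r.2)) q
      (((mfderiv 𝓘(ℂ, E) 𝓘(ℂ, E) φ.symm q.1).comp (ContinuousLinearMap.fst ℂ E ℂ)).prod
        (ContinuousLinearMap.snd ℂ E ℂ)) := by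
    refine HasMFDerivAt.prodMk ?_ hasFDerivAt_snd.hasMFDerivAt
    exact HasMFDerivAt.comp q
      ((contMDiffAt_extChartAt_symm hq).mdifferentiableAt (by simp)).hasMFDerivAt
      hasFDerivAt_fst.hasMFDerivAt
  rw [ModelWithCorners.range_eq_univ, mpullbackWithin_univ, hsymm, mpullback_apply, h1.mfderiv]
  exact inverse_prod_comp_fst_snd (E := E) (f := mfderiv 𝓘(ℂ, E) 𝓘(ℂ, E) φ.symm q.1)
    (isInvertible_mfderiv_extChartAt_symm hq) ((polyEval q.2 w).1 (φ.symm q.1)) c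

/-- `[∂/∂t + a, w] = ∂w/∂t + [a, w]` on `X × ℂ`. -/
theorem mlieBracket_suspension (a w : ℂ[X] ⊗[ℂ] globalSections F) :
    mlieBracket (𝓘(ℂ, E).prod 𝓘(ℂ, ℂ)) (suspension 1 a) (suspension 0 w)
      = suspension 0 (lieDeriv polyDeriv.toAddMonoidHom a w) := by
  funext p
  obtain ⟨x, t⟩ := p
  set φ := extChartAt 𝓘(ℂ, E) x with hφ
  have hx : φ x ∈ φ.target := mem_extChartAt_target x
  have hev : ∀ᶠ q in 𝓝 (φ x, t), q.1 ∈ φ.target :=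
    (continuous_fst.tendsto (φ x, t)) (extChartAt_target_mem_nhds (I := 𝓘(ℂ, E)) x)
  have hpull (c : ℂ) (v : ℂ[X] ⊗[ℂ] globalSections F) :
      mpullbackWithin 𝓘(ℂ, E × ℂ) (𝓘(ℂ, E).prod 𝓘(ℂ, ℂ))
        (extChartAt (𝓘(ℂ, E).prod 𝓘(ℂ, ℂ)) (x, t)).symm (suspension c v)
        (Set.range (𝓘(ℂ, E).prod 𝓘(ℂ, ℂ)))
        =ᶠ[𝓝 (φ x, t)] fun q : E × ℂ => ((chartPath x v (q.2, q.1), c) : E × ℂ) := by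
    filter_upwards [hev] with q hq using mpullbackWithin_suspension (x, t) hq c v
  have hderiv (c : ℂ) (v : ℂ[X] ⊗[ℂ] globalSections F) :
      HasFDerivAt (fun q : E × ℂ => ((chartPath x v (q.2, q.1), c) : E × ℂ))
        (((fderiv ℂ (chartPath x v) (t, φ x)).comp
          ((ContinuousLinearMap.snd ℂ E ℂ).prod (ContinuousLinearMap.fst ℂ E ℂ))).prod 0)
        (φ x, t) := by
    refine HasFDerivAt.prodMk ?_ (hasFDerivAt_const c _)
    exact HasFDerivAt.comp (g := chartPath x v) (φ x, t)
      ((contDiffAt_chartPath (p := (t, φ x)) hx v).differentiableAt (by simp)).hasFDerivAt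
      (hasFDerivAt_snd.prodMk hasFDerivAt_fst)
  have h1 : lieBracket ℂ (fun q : E × ℂ => ((chartPath x a (q.2, q.1), (1 : ℂ)) : E × ℂ))
      (fun q : E × ℂ => ((chartPath x w (q.2, q.1), (0 : ℂ)) : E × ℂ)) (φ x, t)
      = (chartPath x (lieDeriv polyDeriv.toAddMonoidHom a w) (t, φ x), 0) := by
    rw [lieBracket_eq, chartPath_lieDeriv (p := (t, φ x)) hx]
    simp only [(hderiv 1 a).fderiv, (hderiv 0 w).fderiv]
    simp
  have h2 : (chartPath x (lieDeriv polyDeriv.toAddMonoidHom a w) (t, φ x))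
      = (polyEval t (lieDeriv polyDeriv.toAddMonoidHom a w)).1 x :=
    chartField_extChartAt_self x _
  have h3 : extChartAt (𝓘(ℂ, E).prod 𝓘(ℂ, ℂ)) (x, t) (x, t) = (φ x, t) := by
    rw [extChartAt_prod]
    rfl
  rw [← mlieBracketWithin_univ, mlieBracketWithin_apply, mfderiv_extChartAt_self]
  refine (DFunLike.congr_fun (ContinuousLinearMap.inverse_id (R := ℂ) (M := E × ℂ)) _).trans ?_
  rw [ContinuousLinearMap.id_apply, h3, Set.preimage_univ, Set.univ_inter,
    ModelWithCorners.range_eq_univ]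
  simp only [ModelWithCorners.range_eq_univ] at hpull
  exact (congrFun lieBracketWithin_univ (φ x, t)).trans
    (((hpull 1 a).lieBracket_vectorField_eq (hpull 0 w)).trans
      (h1.trans (congrArg (fun e : E => (e, (0 : ℂ))) h2)))

end Product

/-! ### Jets of integral curves -/

section Curves

open VectorField Filter TensorProduct Polynomial

variable {E : Type*} [NormedAddCommGroup E] [NormedSpace ℂ E]
  {X : Type*} [TopologicalSpace X] [ChartedSpace E X]

lemma HolCurve.inChart_zero {y : X} (γ : HolCurve E y) :
    γ.inChart 0 = extChartAt 𝓘(ℂ, E) y y := by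
  simp [HolCurve.inChart, γ.map_zero]

lemma HolCurve.analyticAt_inChart {y : X} (γ : HolCurve E y) :
    AnalyticAt ℂ γ.inChart 0 := by
  have h : ContMDiffAt 𝓘(ℂ, E) 𝓘(ℂ, E) ω (extChartAt 𝓘(ℂ, E) y) (γ.toFun 0) := by
    rw [γ.map_zero]
    exact contMDiffAt_extChartAt
  exact (h.comp 0 γ.holomorphic).contDiffAt.analyticAt

variable [IsManifold 𝓘(ℂ, E) ω X] {F : LieSubsheaf E X}

lemma chartField_extChartAt {x y : X} (hx : x ∈ (extChartAt 𝓘(ℂ, E) y).source)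
    (V : ∀ x : X, TangentSpace 𝓘(ℂ, E) x) :
    chartField y V (extChartAt 𝓘(ℂ, E) y x)
      = mfderiv 𝓘(ℂ, E) 𝓘(ℂ, E) (extChartAt 𝓘(ℂ, E) y) x (V x) := by
  set φ := extChartAt 𝓘(ℂ, E) y with hφ
  obtain ⟨e, he, rfl⟩ : ∃ e ∈ φ.target, φ.symm e = x := ⟨φ x, φ.map_source hx, φ.left_inv hx⟩
  rw [φ.right_inv he, chartField_apply]
  refine (isInvertible_mfderiv_extChartAt_symm he).inverse_apply_eq.2 ?_
  have h := mfderivWithin_extChartAt_symm_comp_mfderiv_extChartAt he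
  simp only [modelWithCornersSelf_coe, Set.range_id, mfderivWithin_univ] at h
  exact (congrArg (fun f => f (V (φ.symm e))) h).symm

variable [CompleteSpace E]

lemma TimeDependentVectorField.IsIntegralCurve.hasDerivAt_inChart
    {A : TimeDependentVectorField E X} {a : ℂ[X] ⊗[ℂ] globalSections F}
    (ha : ∀ t, A.toFun t = (polyEval t a).1) {y : X} {γ : HolCurve E y}
    (hγ : A.IsIntegralCurve γ) :
    ∀ᶠ t in 𝓝 (0 : ℂ), HasDerivAt γ.inChart (chartPath y a (t, γ.inChart t)) t := by
  have hs : ∀ᶠ t in 𝓝 (0 : ℂ), γ.toFun t ∈ (extChartAt 𝓘(ℂ, E) y).source := by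
    refine γ.holomorphic.continuousAt.eventually_mem ?_
    rw [γ.map_zero]
    exact extChartAt_source_mem_nhds y
  filter_upwards [hγ, hs] with t h1 h2
  have h3 : HasMFDerivAt 𝓘(ℂ, E) 𝓘(ℂ, E) (extChartAt 𝓘(ℂ, E) y) (γ.toFun t) _ :=
    (mdifferentiableAt_extChartAt (by simpa using h2)).hasMFDerivAt
  set v : E := A.toFun t (γ.toFun t) with hv
  set D : E →L[ℂ] E := mfderiv 𝓘(ℂ, E) 𝓘(ℂ, E) (extChartAt 𝓘(ℂ, E) y) (γ.toFun t) with hD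
  have h4 : HasFDerivAt γ.inChart (D.comp ((1 : ℂ →L[ℂ] ℂ).smulRight v)) t :=
    (h3.comp t h1).hasFDerivAt
  have h5 : chartPath y a (t, γ.inChart t) = D v := by
    rw [hv, ha t]
    exact chartField_extChartAt h2 _
  rw [h5]
  simpa using h4.hasDerivAt

/-- If the integral curves of `A` and `B` through `y` agree to order `n`, then the Lie derivatives
`L_A ^ k (B - A)`, `k < n`, vanish at `y` at time `0`, and `L_A ^ n (B - A)` is the difference of
the jets of order `n + 1`. -/
theorem lieDeriv_iterate_eq_jet_diff {A B : TimeDependentVectorField E X}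
    {a b : ℂ[X] ⊗[ℂ] globalSections F} (ha : ∀ t, A.toFun t = (polyEval t a).1)
    (hb : ∀ t, B.toFun t = (polyEval t b).1) {y : X} {γ δ : HolCurve E y}
    (hγ : A.IsIntegralCurve γ) (hδ : B.IsIntegralCurve δ) {n : ℕ}
    (hγδ : (jetSetoid E n y).r γ δ) :
    (∀ k < n, (polyEval 0 ((lieDeriv polyDeriv.toAddMonoidHom a)^[k] (b - a))).1 y = 0) ∧
      (polyEval 0 ((lieDeriv polyDeriv.toAddMonoidHom a)^[n] (b - a))).1 y
        = iteratedDeriv (n + 1) δ.inChart 0 - iteratedDeriv (n + 1) γ.inChart 0 := by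
  have hφ (t : ℂ) : (t, extChartAt 𝓘(ℂ, E) y y).2 ∈ (extChartAt 𝓘(ℂ, E) y).target :=
    mem_extChartAt_target y
  have hev : ∀ᶠ p in 𝓝 ((0 : ℂ), extChartAt 𝓘(ℂ, E) y y),
      p.2 ∈ (extChartAt 𝓘(ℂ, E) y).target :=
    (continuous_snd.tendsto ((0 : ℂ), extChartAt 𝓘(ℂ, E) y y))
      (extChartAt_target_mem_nhds (I := 𝓘(ℂ, E)) y)
  have h := lieDerivative_eq_iteratedDeriv_sub
    (w := fun k => chartPath y ((lieDeriv polyDeriv.toAddMonoidHom a)^[k] (b - a)))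
    (contDiffAt_chartPath (hφ 0) a).analyticAt (contDiffAt_chartPath (hφ 0) b).analyticAt
    γ.analyticAt_inChart δ.analyticAt_inChart γ.inChart_zero (hγ.hasDerivAt_inChart ha)
    (hδ.hasDerivAt_inChart hb) hγδ
    (by
      refine Eventually.of_forall fun p => ?_
      have := congrFun (chartPath_add y (b - a) a) p
      rw [sub_add_cancel, Pi.add_apply] at this
      exact eq_sub_of_add_eq this.symm)
    (fun k => (contDiffAt_chartPath (hφ 0) _).analyticAt)
    (fun k => by
      filter_upwards [hev] with p hp
      rw [Function.iterate_succ_apply']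
      exact chartPath_lieDeriv hp a _)
  have e (v : ℂ[X] ⊗[ℂ] globalSections F) :
      chartPath y v (0, extChartAt 𝓘(ℂ, E) y y) = (polyEval 0 v).1 y :=
    chartField_extChartAt_self y _
  exact ⟨fun k hk => (e _).symm.trans (h.1 k hk), (e _).symm.trans h.2⟩

end Curves

/-! ### Admissible vector fields -/

section Main

open VectorField Filter TensorProduct Polynomial

variable {E : Type*} [NormedAddCommGroup E] [NormedSpace ℂ E] [CompleteSpace E]
  {X : Type*} [TopologicalSpace X] [ChartedSpace E X] [IsManifold 𝓘(ℂ, E) ω X]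
  {F : LieSubsheaf E X}

lemma TimeDependentVectorField.InSheaf.exists_polyEval {A : TimeDependentVectorField E X}
    (hA : A.InSheaf F) :
    ∃ a : ℂ[X] ⊗[ℂ] globalSections F, ∀ t, A.toFun t = (polyEval t a).1 := by
  obtain ⟨N, a, ha, hA⟩ := hA
  refine ⟨∑ i ∈ Finset.range N, (Polynomial.X ^ i) ⊗ₜ[ℂ] (⟨a i, ha i⟩ : globalSections F),
    fun t => funext fun x => ?_⟩
  rw [hA t x, map_sum, AddSubmonoidClass.coe_finsetSum, Finset.sum_apply]
  simp

lemma lieIterate_eq_suspension {A : TimeDependentVectorField E X}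
    {a : ℂ[X] ⊗[ℂ] globalSections F} (ha : ∀ t, A.toFun t = (polyEval t a).1) (m : ℕ) :
    A.lieIterate m = suspension 0 ((lieDeriv polyDeriv.toAddMonoidHom a)^[m] a) := by
  have h1 : A.flowField = suspension 1 a := by
    funext p
    exact congrArg (fun V : ∀ x : X, TangentSpace 𝓘(ℂ, E) x => ((V p.1, 1) : E × ℂ)) (ha p.2)
  induction m with
  | zero =>
    funext p
    exact congrArg (fun V : ∀ x : X, TangentSpace 𝓘(ℂ, E) x => ((V p.1, 0) : E × ℂ)) (ha p.2)
  | succ m ih =>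
    rw [TimeDependentVectorField.lieIterate] at ih ⊢
    rw [Function.iterate_succ_apply', Function.iterate_succ_apply', ih, h1]
    exact mlieBracket_suspension a _

lemma atTimeZero_lieIterate {A : TimeDependentVectorField E X}
    {a : ℂ[X] ⊗[ℂ] globalSections F} (ha : ∀ t, A.toFun t = (polyEval t a).1) (m : ℕ) :
    atTimeZero (A.lieIterate m)
      = (polyEval 0 ((lieDeriv polyDeriv.toAddMonoidHom a)^[m] a)).1 := by
  rw [lieIterate_eq_suspension ha]
  rfl

/-- The global sections of `F` whose restriction to `Y` is a section of `G`. -/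
def sectionsRestrictingTo (F : LieSubsheaf E X) {Y : Set X}
    (G : AbelianSubsheaf (fun y : Y => TangentSpace 𝓘(ℂ, E) (y : X))) :
    AddSubgroup (globalSections F) where
  carrier := {a | G.IsSection ⊤ fun y => a.1 y}
  zero_mem' := G.zero_mem ⊤
  add_mem' := G.add_mem
  neg_mem' := G.neg_mem

end Main

end JetDeformation

theorem proposition3p3
    {E : Type*} [NormedAddCommGroup E] [NormedSpace ℂ E] [FiniteDimensional ℂ E]
    {X : Type*} [TopologicalSpace X] [T2Space X] [ChartedSpace E X] [IsManifold 𝓘(ℂ, E) ω X]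
    (F : JetDeformation.LieSubsheaf E X)
    (Y : Set X) (hY : JetDeformation.IsAnalyticSubset E Y)
    (G : JetDeformation.AbelianSubsheaf (fun y : Y => TangentSpace 𝓘(ℂ, E) (y : X)))
    (hG : JetDeformation.IsObstructionSheaf F Y G)
    (n : ℕ) (hn : 1 ≤ n)
    (A B : JetDeformation.TimeDependentVectorField E X)
    (hA : JetDeformation.IsAdmissible F G n A)
    (hB : JetDeformation.IsAdmissible F G n B)
    (hAB : ∀ y ∈ Y, JetDeformation.inducedJet A n y = JetDeformation.inducedJet B n y) :
    G.IsSection ⊤ (fun y => JetDeformation.Jet.diff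
      (JetDeformation.inducedJet B (n + 1) (y : X))
      (JetDeformation.inducedJet A (n + 1) (y : X))) := by
  have : CompleteSpace E := FiniteDimensional.complete ℂ E
  obtain ⟨a, ha⟩ := hA.inSheaf.exists_polyEval
  obtain ⟨b, hb⟩ := hB.inSheaf.exists_polyEval
  have hjet (y : X) (hy : y ∈ Y) := JetDeformation.lieDeriv_iterate_eq_jet_diff ha hb
    (A.exists_isIntegralCurve y).choose_spec (B.exists_isIntegralCurve y).choose_spec
    (Quotient.exact (hAB y hy))
  have hmem : JetDeformation.polyEval 0
      ((JetDeformation.lieDeriv JetDeformation.polyDeriv.toAddMonoidHom a)^[n] (b - a))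
      ∈ JetDeformation.sectionsRestrictingTo F G := by
    refine JetDeformation.ev_iterate_lieDeriv_sub_mem
      (ev := (JetDeformation.polyEval 0).toAddMonoidHom)
      (d := JetDeformation.polyDeriv.toAddMonoidHom) (Z := {z | ∀ y ∈ Y, z.1 y = 0})
      (JetDeformation.polyEval_lie 0) JetDeformation.polyDeriv_lie ?_
      (fun k hk y hy => (hjet y hy).1 k hk) ?_ ?_
    · -- `z + w` and `w` agree along `Y`, and `[z + w, w] = [z, w]`
      intro z hz w
      have h := hG.bracket_mem ⊤ (z + w).1 w.1 (z + w).2 w.2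
        fun y hy _ => by simp [hz y hy]
      have h' : ⁅z + w, w⁆ = ⁅z, w⁆ := by rw [add_lie, lie_self, add_zero]
      rw [← JetDeformation.coe_lie, h'] at h
      exact h
    · have h := hA.lie_mem n hn le_rfl
      rw [JetDeformation.atTimeZero_lieIterate ha] at h
      exact h
    · have h := hB.lie_mem n hn le_rfl
      rw [JetDeformation.atTimeZero_lieIterate hb] at h
      exact h
  exact G.congr (fun y _ => (hjet y y.2).2) hmem
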